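/- A permutation of length $n\ge 0$ is an ordering $\pi=\pi_1\pi_2\cdots\pi_n$ of the integers $1,\dots,n$. For permutations $\sigma,\pi$ write $\sigma\le\pi$ if $\sigma$ occurs in $\pi$ as a pattern, i.e. if some subsequence of $\pi$ has its letters in the same relative order as the letters of $\sigma$; this is a partial order on the set of all permutations. A descent of $\pi$ is an index $i$ with $1\le i<n$ and $\pi_i>\pi_{i+1}$. Definitions. Let $P$ be a finite bounded poset (least element $\hat 0$, greatest element $\hat 1$) which is pure, i.e. all its maximal chains have the same length. A chain-edge labeling of $P$ assigns to every edge $c_{i}\lessdot c_{i+1}$ of every maximal chain $c$ of $P$ an element of some poset $\Lambda$, in such a way that if two maximal chains coincide along their bottom $d$ edges, then their labels on these $d$ edges coincide as well. For $x\le y$ in $P$ and a maximal chain $r$ of $[\hat 0,x]$, each maximal chain $m$ of $[x,y]$ then has a well-defined sequence of labels, read off from any maximal chain of $P$ that contains $r\cup m$. The labeling is a CL-labeling if, for all $x\le y$ and all $r$, exactly one maximal chain of $[x,y]$ has a strictly increasing label sequence, and this sequence lexicographically precedes that of every other maximal chain of $[x,y]$. The poset $P$ is CL-shellable if it has a CL-labeling,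 and dual CL-shellable if its order dual is CL-shellable. A finite simplicial complex $\Delta$ (the empty set counts as a face, of dimension $-1$) is shellable if it is pure, i.e. all its facets (maximal faces) have the same dimension, and its facets can be listed without repetition as $F_1,\dots,F_t$ so that for $2\le k\le t$ the complex $\bigl(\bigcup_{i=1}^{k-1}\langle F_i\rangle\bigr)\cap\langle F_k\rangle$ is pure of dimension $\dim\Delta-1$, where $\langle F\rangle=\{G: G\subseteq F\}$. An interval $[\sigma,\pi]$ is called shellable if its order complex $\Delta(\sigma,\pi)$, whose faces are the chains contained in $[\sigma,\pi]\setminus\{\sigma,\pi\}$, is shellable. Statement. Let $\sigma\le\pi$ be permutations with the same number of descents. Then the interval $[\sigma,\pi]=\{\tau:\sigma\le\tau\le\pi\}$ in the pattern-containment order is dual CL-shellable, and it is shellable. -/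

import Mathlib

/-! ### Permutations ordered by pattern containment -/

/-- A permutation of some length `n`: the one-line word `π₁ … πₙ` is recorded as the bijection
`i ↦ πᵢ` of `Fin n` (positions and letters are numbered from `0`). -/
structure Permutation where
  length : ℕ
  letter : Equiv.Perm (Fin length)

namespace Permutation

/-- `σ` occurs as a pattern in `π`: there are positions `e 0 < e 1 < ⋯` of `π` such that the letters
of `π` at these positions are in the same relative order as the letters of `σ`. -/
def Contained (σ π : Permutation) : Prop :=
  ∃ e : Fin σ.length ↪o Fin π.length,
    ∀ i j, σ.letter i < σ.letter j ↔ π.letter (e i) < π.letter (e j)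

theorem Contained.length_le {σ π : Permutation} (h : σ.Contained π) : σ.length ≤ π.length := by
  obtain ⟨e, -⟩ := h
  simpa using Fintype.card_le_of_injective e e.injective

theorem Contained.antisymm {σ π : Permutation} (h : σ.Contained π) (h' : π.Contained σ) :
    σ = π := by
  have hl := le_antisymm h.length_le h'.length_le
  obtain ⟨m, s⟩ := σ
  obtain ⟨n, p⟩ := π
  obtain rfl : m = n := hl
  obtain ⟨e, he⟩ := h
  have hid : ∀ e : Fin m ↪o Fin m, ∀ i, e i = i := by
    intro e i
    let f : Fin m ≃o Fin m :=
      StrictMono.orderIsoOfSurjective e e.strictMono (Finite.surjective_of_injective e.injective)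
    exact congrArg (fun g : Fin m ≃o Fin m => g i) (Subsingleton.elim f (OrderIso.refl _))
  simp only [hid e] at he
  have hmono : StrictMono fun i => p (s.symm i) := by
    intro i j hij
    exact (he _ _).1 (by simpa using hij)
  have hs : p = s := by
    ext i
    have := hid (OrderEmbedding.ofStrictMono _ hmono) (s i)
    simpa using congrArg Fin.val this
  rw [hs]

/-- The poset of all permutations, ordered by pattern containment. -/
instance : PartialOrder Permutation where
  le := Contained
  le_refl σ := ⟨RelEmbedding.refl _, fun _ _ => Iff.rfl⟩
  le_trans := by
    rintro σ τ π ⟨e, he⟩ ⟨f, hf⟩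
    exact ⟨e.trans f, fun i j => (he i j).trans (hf _ _)⟩
  le_antisymm _ _ h h' := h.antisymm h'

/-- The number of descents, i.e. of positions `i` such that `πᵢ > πᵢ₊₁`. -/
noncomputable def des (π : Permutation) : ℕ :=
  Nat.card {i : Fin π.length //
    ∃ h : i.val + 1 < π.length, π.letter ⟨i.val + 1, h⟩ < π.letter i}

end Permutation

/-! ### CL-shellable posets -/

/-- `SatChain x l y`: the list `l = [l₀, …, lₖ₋₁]` describes a maximal chain
`x ⋖ l₀ ⋖ ⋯ ⋖ lₖ₋₁ = y` of the interval `[x, y]`; it has `k` edges. The bottom element `x` is not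
an entry of `l`, so that chains are composed by appending lists. -/
def SatChain {P : Type*} [PartialOrder P] : P → List P → P → Prop
  | x, [], y => x = y
  | x, a :: l, y => x ⋖ a ∧ SatChain a l y

/-- A chain-edge labeling of a bounded poset: `lab c i` is the label of the `i`-th edge from the
bottom (`i = 0, 1, …`) of the maximal chain `c`, and if two maximal chains coincide along their
bottom `d` edges then so do their labels. (Only values at maximal chains `c` and `i < c.length` are
meaningful.) -/
def IsChainEdgeLabeling {P Λ : Type*} [PartialOrder P] [BoundedOrder P]
    (lab : List P → ℕ → Λ) : Prop :=
  ∀ c c' : List P, SatChain ⊥ c ⊤ → SatChain ⊥ c' ⊤ →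
    ∀ d, c.take d = c'.take d → ∀ i < d, lab c i = lab c' i

/-- The labels of the edges of `m` in the chain which runs first through `r`, then through `m`,
then through `t`. -/
def edgeLabels {P Λ : Type*} (lab : List P → ℕ → Λ) (r m t : List P) : List Λ :=
  (List.range m.length).map fun i => lab (r ++ m ++ t) (r.length + i)

/-- A CL-labeling: a chain-edge labeling such that every rooted interval `[x, y]_r`, with `r` a
maximal chain of `[⊥, x]`, has a unique maximal chain with strictly increasing labels, and this
chain lexicographically precedes all other maximal chains of `[x, y]_r`. The labels of a maximal
chain `m` of `[x, y]_r` are read off from a maximal chain `r ∪ m ∪ t` of the poset; they do not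
depend on the choice of `t`, because the labeling is a chain-edge labeling. -/
def IsCLLabeling {P Λ : Type*} [PartialOrder P] [BoundedOrder P] [PartialOrder Λ]
    (lab : List P → ℕ → Λ) : Prop :=
  IsChainEdgeLabeling lab ∧
  ∀ (x y : P) (r t : List P), x ≤ y → SatChain ⊥ r x → SatChain y t ⊤ →
    ∃ m, SatChain x m y ∧ (edgeLabels lab r m t).IsChain (· < ·) ∧
      ∀ m', SatChain x m' y → m' ≠ m →
        ¬ (edgeLabels lab r m' t).IsChain (· < ·) ∧
        List.Lex (· < ·) (edgeLabels lab r m t) (edgeLabels lab r m' t)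

/-- A poset is CL-shellable if it is finite, bounded, pure (all maximal chains have the same length)
and has a CL-labeling with labels in some poset `Λ`. -/
def IsCLShellable (P : Type*) [PartialOrder P] : Prop :=
  Finite P ∧ ∃ _ : BoundedOrder P,
    (∀ c c' : List P, SatChain ⊥ c ⊤ → SatChain ⊥ c' ⊤ → c.length = c'.length) ∧
    ∃ (Λ : Type) (_ : PartialOrder Λ) (lab : List P → ℕ → Λ), IsCLLabeling lab

/-- A poset is dual CL-shellable if its order dual is CL-shellable. -/
def IsDualCLShellable (P : Type*) [PartialOrder P] : Prop :=
  IsCLShellable Pᵒᵈ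

/-! ### Shellable simplicial complexes

An abstract simplicial complex on the vertex set `V` is given by its faces, a family of finite
subsets of `V` that is closed under taking subsets, i.e. a lower set in `Finset V`. The empty set
counts as a face, of dimension `-1`. The union and the intersection of complexes are `⊔` and `⊓`,
and the complex `⟨F⟩` generated by one face is `LowerSet.Iic F`. -/

/-- A facet is a face that is maximal with respect to inclusion. -/
def IsFacet {V : Type*} (K : LowerSet (Finset V)) (F : Finset V) : Prop :=
  Maximal (· ∈ K) F

/-- The complex is non-void and pure of dimension `d`: all facets have dimension `d`, i.e. have
`d + 1` vertices. -/
def IsPureOfDim {V : Type*} (K : LowerSet (Finset V)) (d : ℤ) : Prop :=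
  (∃ F, F ∈ K) ∧ ∀ F, IsFacet K F → (F.card : ℤ) = d + 1

/-- A finite complex that is pure of some dimension `d` is shellable if its facets can be listed
without repetition as `F 0, …, F (t - 1)` so that, for each `k` other than the first one, the
intersection of `⟨F k⟩` with the union of the `⟨F i⟩`, `i < k`, is pure of dimension `d - 1`. -/
def IsShellable {V : Type*} (K : LowerSet (Finset V)) : Prop :=
  (K : Set (Finset V)).Finite ∧ ∃ d : ℤ, IsPureOfDim K d ∧
    ∃ (t : ℕ) (F : Fin t → Finset V), Function.Injective F ∧
      (∀ G, IsFacet K G ↔ ∃ i, F i = G) ∧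
      ∀ k : Fin t, 0 < k.val →
        IsPureOfDim ((⨆ i : {i : Fin t // i < k}, LowerSet.Iic (F i.val)) ⊓ LowerSet.Iic (F k))
          (d - 1)

/-- The complex whose faces are the finite chains of the poset `Q`. -/
def chainComplex (Q : Type*) [PartialOrder Q] : LowerSet (Finset Q) where
  carrier := {s | IsChain (· ≤ ·) (s : Set Q)}
  lower' := fun _ _ hba ha => IsChain.mono (Finset.coe_subset.2 hba) ha

/-- The order complex `Δ(a, b)` of the interval `[a, b]`: its faces are the chains contained in the
interior `[a, b] \ {a, b}`. -/
def orderComplex {P : Type*} [PartialOrder P] (a b : P) : LowerSet (Finset (Set.Ioo a b)) :=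
  chainComplex (Set.Ioo a b)

/-! ### Saturated chains -/

section SatChain

variable {P : Type*} [PartialOrder P]

/-! Cut a permutation into its ascending runs and record, value by value, the index of the run
containing that value. A permutation with d descents becomes a word over {0, …, d}, and between
permutations with equally many descents pattern containment is the subword order
(`Permutation.le_iff_word_sublist`). The number of descents is monotone under containment, hence
constant on [σ, π], and every word between the two end words comes from a permutation of the
interval (`Permutation.exists_word_eq`). So [σ, π] is an interval of the subword order.

Read downwards, such an interval has a CL-labeling: a cover deletes one letter, taken leftmost among
the choices giving the same word, and its label is the position of that letter in the top word.
Always deleting the leftmost letter that can be spared gives the unique increasing and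
lexicographically first chain (`exists_increasing_satChain`).

A CL-labeling yields a shelling: maximal chains are listed compatibly with the lexicographic order
of their labels, and a chain is improved by changing one element at a non-ascent
(`IsCLLabeling.exchange`). Dualizing does not affect which sets are chains. -/

theorem satChain_append_iff {x z : P} {l l' : List P} :
    SatChain x (l ++ l') z ↔ ∃ y, SatChain x l y ∧ SatChain y l' z := by
  induction l generalizing x with
  | nil => simp [SatChain]
  | cons a l ih => simp [SatChain, ih, and_assoc]

theorem SatChain.append {x y z : P} {l l' : List P} (h : SatChain x l y) (h' : SatChain y l' z) :
    SatChain x (l ++ l') z :=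
  satChain_append_iff.2 ⟨y, h, h'⟩

theorem SatChain.le {x y : P} {l : List P} (h : SatChain x l y) : x ≤ y := by
  induction l generalizing x with
  | nil => exact le_of_eq h
  | cons a l ih => exact h.1.le.trans (ih h.2)

theorem SatChain.lt_of_mem {x y a : P} {l : List P} (h : SatChain x l y) (ha : a ∈ l) : x < a := by
  induction l generalizing x with
  | nil => simp at ha
  | cons b l ih =>
    rcases List.mem_cons.1 ha with rfl | ha
    · exact h.1.lt
    · exact h.1.lt.trans (ih h.2 ha)

theorem SatChain.le_of_mem {x y a : P} {l : List P} (h : SatChain x l y) (ha : a ∈ l) : a ≤ y := by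
  induction l generalizing x with
  | nil => simp at ha
  | cons b l ih =>
    rcases List.mem_cons.1 ha with rfl | ha
    · exact h.2.le
    · exact ih h.2 ha

theorem SatChain.pairwise {x y : P} {l : List P} (h : SatChain x l y) : l.Pairwise (· < ·) := by
  induction l generalizing x with
  | nil => simp
  | cons b l ih => exact List.pairwise_cons.2 ⟨fun a ha => h.2.lt_of_mem ha, ih h.2⟩

theorem SatChain.nodup {x y : P} {l : List P} (h : SatChain x l y) : l.Nodup :=
  h.pairwise.imp fun h => h.ne

theorem SatChain.eq_nil {x : P} {l : List P} (h : SatChain x l x) : l = [] :=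
  List.eq_nil_iff_forall_not_mem.2 fun _ ha => ((h.lt_of_mem ha).trans_le (h.le_of_mem ha)).false

theorem SatChain.end_mem {x y : P} {l : List P} (h : SatChain x l y) (hl : l ≠ []) : y ∈ l := by
  induction l generalizing x with
  | nil => exact absurd rfl hl
  | cons b l ih =>
    by_cases hl' : l = []
    · subst hl'
      rw [show y = b from h.2.symm]
      simp
    · exact List.mem_cons_of_mem _ (ih h.2 hl')

theorem exists_satChain [Finite P] {x y : P} (h : x ≤ y) : ∃ l, SatChain x l y := by
  induction x using (wellFounded_gt (α := P)).induction with
  | _ x ih =>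
    rcases h.eq_or_lt with rfl | hlt
    · exact ⟨[], rfl⟩
    · obtain ⟨z, hz, hzy⟩ := exists_covBy_le_of_lt hlt
      obtain ⟨l, hl⟩ := ih z hz.lt hzy
      exact ⟨z :: l, hz, hl⟩

/-- Refinement to a saturated chain, splitting at the greatest element of `s`. The condition `x < a`
is there because the list of a `SatChain` omits its bottom element. -/
theorem exists_satChain_of_isChain [Finite P] {x y : P} (hxy : x ≤ y) (s : Finset P)
    (hs : IsChain (· ≤ ·) (s : Set P)) (hsxy : ∀ a ∈ s, x ≤ a ∧ a ≤ y) :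
    ∃ l, SatChain x l y ∧ ∀ a ∈ s, x < a → a ∈ l := by
  classical
  induction hn : s.card generalizing s y with
  | zero =>
    obtain ⟨l, hl⟩ := exists_satChain hxy
    exact ⟨l, hl, by simp [Finset.card_eq_zero.1 hn]⟩
  | succ n ih =>
    have hne : s.Nonempty := Finset.card_pos.1 (by omega)
    obtain ⟨z, hz⟩ := s.exists_maximal hne
    obtain ⟨l, hl, hmem⟩ := ih (hsxy z hz.1).1 (s.erase z)
      (hs.mono (by simp)) (fun a ha => by
        have ha' := Finset.mem_of_mem_erase ha
        refine ⟨(hsxy a ha').1, ?_⟩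
        rcases hs.total ha' hz.1 with h | h
        · exact h
        · exact hz.2 ha' h) (by rw [Finset.card_erase_of_mem hz.1, hn]; rfl)
    obtain ⟨l', hl'⟩ := exists_satChain (hsxy z hz.1).2
    refine ⟨l ++ l', hl.append hl', fun a ha hxa => ?_⟩
    by_cases haz : a = z
    · subst haz
      refine List.mem_append_left _ (hl.end_mem ?_)
      rintro rfl
      exact hxa.ne hl
    · exact List.mem_append_left _ (hmem a (Finset.mem_erase.2 ⟨haz, ha⟩) hxa)

end SatChain

/-! ### CL-shellable posets have shellable order complexes -/

section Shelling

theorem List.Lex.append_of_length_eq {Λ : Type*} {r : Λ → Λ → Prop} {a b : List Λ}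
    (h : List.Lex r a b) (hl : a.length = b.length) (c d : List Λ) :
    List.Lex r (a ++ c) (b ++ d) := by
  induction h with
  | nil => simp at hl
  | rel h => exact .rel h
  | cons _ ih => exact .cons (ih (by simpa using hl))

theorem List.exists_first {α : Type*} (p : α → Prop) {l : List α} (h : ∃ a ∈ l, p a) :
    ∃ l₁ a l₂, l = l₁ ++ a :: l₂ ∧ p a ∧ ∀ b ∈ l₁, ¬ p b := by
  classical
  induction l with
  | nil => simp at h
  | cons b l ih =>
    by_cases hb : p b
    · exact ⟨[], b, l, rfl, hb, by simp⟩
    · obtain ⟨l₁, a, l₂, rfl, ha, hl⟩ := ih (by simpa [hb] using h)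
      exact ⟨b :: l₁, a, l₂, rfl, ha, by simpa [hb] using hl⟩

theorem List.exists_append_of_ne {α : Type*} {c c' : List α} (hne : c ≠ c')
    (hl : c.length = c'.length) :
    ∃ r a s a' s', c = r ++ a :: s ∧ c' = r ++ a' :: s' ∧ a ≠ a' := by
  induction c generalizing c' with
  | nil => exact absurd (List.length_eq_zero_iff.1 hl.symm).symm hne
  | cons a s ih =>
    match c', hl with
    | a' :: s', hl =>
      by_cases h : a = a'
      · subst h
        obtain ⟨r, b, t, b', t', h₁, h₂, h₃⟩ := ih (c' := s') (by simpa using hne) (by simpa using hl)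
        exact ⟨a :: r, b, t, b', t', by simp [h₁], by simp [h₂], h₃⟩
      · exact ⟨[], a, s, a', s', rfl, rfl, h⟩

/-- Labels live in a mere poset, so comparing label sequences orders the maximal chains only
partially; the shelling uses a linear extension. -/
theorem exists_fin_enumeration {M : Type*} [Finite M] (R : M → M → Prop) [IsStrictOrder M R] :
    ∃ (t : ℕ) (f : Fin t ≃ M), ∀ i j, R (f i) (f j) → i < j := by
  classical
  let : PartialOrder M := partialOrderOfSO R
  have : Fintype (LinearExtension M) := Fintype.ofFinite M
  let e : Fin _ ≃o LinearExtension M := monoEquivOfFin (LinearExtension M) rfl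
  refine ⟨_, e.toEquiv, fun i j h => ?_⟩
  have hle : (toLinearExtension (e i : M) : LinearExtension M) ≤ toLinearExtension (e j : M) :=
    toLinearExtension.monotone (Or.inr h)
  refine lt_of_le_of_ne (e.le_iff_le.1 hle) ?_
  rintro rfl
  exact irrefl_of R _ h

variable {P Λ : Type*}

theorem edgeLabels_append (lab : List P → ℕ → Λ) (r m m' t : List P) :
    edgeLabels lab r (m ++ m') t = edgeLabels lab r m (m' ++ t) ++ edgeLabels lab (r ++ m) m' t := by
  simp [edgeLabels, List.range_add, Function.comp_def, add_assoc]

@[simp] theorem length_edgeLabels (lab : List P → ℕ → Λ) (r m t : List P) :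
    (edgeLabels lab r m t).length = m.length := by
  simp [edgeLabels]

variable [PartialOrder P] [BoundedOrder P] {lab : List P → ℕ → Λ}

theorem IsChainEdgeLabeling.edgeLabels_congr (hlab : IsChainEdgeLabeling lab) {r m t t' : List P}
    (h : SatChain ⊥ (r ++ m ++ t) ⊤) (h' : SatChain ⊥ (r ++ m ++ t') ⊤) :
    edgeLabels lab r m t = edgeLabels lab r m t' := by
  refine List.map_congr_left fun i hi => hlab _ _ h h' (r ++ m).length ?_ _ ?_
  · rw [List.take_left, List.take_left]
  · simpa using hi

variable [PartialOrder Λ]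

/-- Replacing a middle segment by one with lexicographically smaller labels makes the labels of the
whole chain lexicographically smaller. -/
theorem IsChainEdgeLabeling.lex_of_lex (hlab : IsChainEdgeLabeling lab) {r m m' t t' : List P}
    (h : SatChain ⊥ (r ++ m ++ t) ⊤) (h₁ : SatChain ⊥ (r ++ m' ++ t) ⊤)
    (h' : SatChain ⊥ (r ++ m' ++ t') ⊤) (hl : m.length = m'.length)
    (hlex : List.Lex (· < ·) (edgeLabels lab r m t) (edgeLabels lab r m' t)) :
    List.Lex (· < ·) (edgeLabels lab [] (r ++ m ++ t) []) (edgeLabels lab [] (r ++ m' ++ t') []) := by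
  rw [hlab.edgeLabels_congr h₁ h'] at hlex
  rw [edgeLabels_append lab [] (r ++ m), edgeLabels_append lab [] (r ++ m'),
    edgeLabels_append lab [] r, edgeLabels_append lab [] r]
  -- The labels along `r` agree because the two chains coincide there. The tails are irrelevant: the
  -- middle segments have equal length and are already strictly compared.
  have hr : edgeLabels lab [] r (m ++ (t ++ [])) = edgeLabels lab [] r (m' ++ (t' ++ [])) :=
    hlab.edgeLabels_congr (by simpa using h) (by simpa using h')
  rw [hr]
  simp only [List.append_assoc]
  refine List.Lex.append_left _ ?_ _
  exact List.Lex.append_of_length_eq (by simpa using hlex) (by simpa using hl) _ _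

/-- This is the shelling condition for chains. Where `c` leaves `c'` and later meets it again, the
segment of `c` cannot be increasing; `z` is a non-ascent inside it, and `c''` replaces `z` by the
increasing choice. -/
theorem IsCLLabeling.exchange (hlab : IsCLLabeling lab)
    (hpure : ∀ c c' : List P, SatChain ⊥ c ⊤ → SatChain ⊥ c' ⊤ → c.length = c'.length)
    {c c' : List P} (hc : SatChain ⊥ c ⊤) (hc' : SatChain ⊥ c' ⊤) (hne : c ≠ c')
    (hlex : ¬ List.Lex (· < ·) (edgeLabels lab [] c []) (edgeLabels lab [] c' [])) :
    ∃ c'' z, SatChain ⊥ c'' ⊤ ∧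
      List.Lex (· < ·) (edgeLabels lab [] c'' []) (edgeLabels lab [] c []) ∧
      z ∈ c ∧ z ≠ ⊤ ∧ z ∉ c' ∧ ∀ a ∈ c, a ≠ z → a ∈ c'' := by
  obtain ⟨r, a, s, a', s', rfl, rfl, haa⟩ := List.exists_append_of_ne hne (hpure _ _ hc hc')
  obtain ⟨x, hrx, hxs⟩ := satChain_append_iff.1 hc
  obtain ⟨x', hrx', hxs'⟩ := satChain_append_iff.1 hc'
  obtain rfl : x = x' := by
    rcases r.eq_nil_or_concat with rfl | ⟨r, b, rfl⟩
    · exact hrx.symm.trans hrx'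
    · rw [List.concat_eq_append] at hrx hrx'
      obtain ⟨_, _, h⟩ := satChain_append_iff.1 hrx
      obtain ⟨_, _, h'⟩ := satChain_append_iff.1 hrx'
      exact h.2.symm.trans h'.2
  -- `y` is the first element of `c` after the branching point `x` that lies on `c'` again; `⊤`
  -- shows that there is one.
  obtain ⟨m₀, y, t, hs, hy, hm₀⟩ := List.exists_first (· ∈ a' :: s') (l := a :: s)
    ⟨⊤, hxs.end_mem (by simp), hxs'.end_mem (by simp)⟩
  obtain ⟨m₀', t', hs'⟩ := List.append_of_mem hy
  have hmm : m₀ ++ [y] ≠ m₀' ++ [y] := by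
    intro h
    have h0 : m₀ = m₀' := by simpa using h
    subst h0
    cases m₀ with
    | nil => simp_all
    | cons b m => simp_all
  have hceq : r ++ a :: s = r ++ (m₀ ++ [y]) ++ t := by simp [hs]
  have hceq' : r ++ a' :: s' = r ++ (m₀' ++ [y]) ++ t' := by simp [hs']
  rw [hceq] at hc hlex ⊢
  rw [hceq'] at hc' hlex
  have hxy : SatChain x (m₀ ++ [y]) y ∧ SatChain y t ⊤ := by
    rw [hs, show m₀ ++ y :: t = (m₀ ++ [y]) ++ t by simp] at hxs
    obtain ⟨y', h1, h2⟩ := satChain_append_iff.1 hxs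
    obtain ⟨_, _, h⟩ := satChain_append_iff.1 h1
    obtain rfl : y = y' := h.2
    exact ⟨h1, h2⟩
  have hxy' : SatChain x (m₀' ++ [y]) y := by
    rw [hs', show m₀' ++ y :: t' = (m₀' ++ [y]) ++ t' by simp] at hxs'
    obtain ⟨y', h1, h2⟩ := satChain_append_iff.1 hxs'
    obtain ⟨_, _, h⟩ := satChain_append_iff.1 h1
    obtain rfl : y = y' := h.2
    exact h1
  -- An increasing segment would precede that of `c'` lexicographically, and then `c` would precede
  -- `c'`, against `hlex`.
  have hinc : ¬ (edgeLabels lab r (m₀ ++ [y]) t).IsChain (· < ·) := by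
    intro hinc
    obtain ⟨m, hm, -, huniq⟩ := hlab.2 x y r t hxy.1.le hrx hxy.2
    obtain rfl : m₀ ++ [y] = m := by
      by_contra h
      exact (huniq _ hxy.1 h).1 hinc
    have hc₁ := (hrx.append hxy').append hxy.2
    have hlen := hpure _ _ hc hc₁
    exact hlex (hlab.1.lex_of_lex hc hc₁ hc' (by simpa using hlen) (huniq _ hxy' hmm.symm).2)
  rw [List.isChain_iff_getElem] at hinc
  push Not at hinc
  obtain ⟨i, hi, hdesc⟩ := hinc
  simp only [length_edgeLabels, List.length_append, List.length_singleton] at hi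
  obtain ⟨m₁, z, y₂, m₂, hm, hlen₁⟩ : ∃ m₁ z y₂ m₂, m₀ ++ [y] = m₁ ++ z :: y₂ :: m₂ ∧
      m₁.length = i := by
    refine ⟨(m₀ ++ [y]).take i, (m₀ ++ [y])[i]'(by simp; omega), (m₀ ++ [y])[i+1]'(by simp; omega),
      (m₀ ++ [y]).drop (i + 2), ?_, by simp; omega⟩
    rw [List.getElem_cons_drop, List.getElem_cons_drop, List.take_append_drop]
  have hzm : z ∈ m₀ := by
    have : m₀ = m₁ ++ z :: (y₂ :: m₂).dropLast := by
      have := congrArg List.dropLast hm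
      rw [List.dropLast_concat] at this
      rw [this, List.dropLast_append_of_ne_nil (by simp)]
      simp
    rw [this]; simp
  rw [hm] at hc hxy
  obtain ⟨x₂, h1, hz, hzy, h2⟩ := satChain_append_iff.1 hxy.1
  -- The increasing chain `mm` of the rank-two interval `[x₂, y₂]` differs from `[z, y₂]`, so it is
  -- lexicographically smaller.
  obtain ⟨mm, hmm', hinc', huniq⟩ := hlab.2 x₂ y₂ (r ++ m₁) (m₂ ++ t) (hz.le.trans hzy.le)
    (hrx.append h1) (h2.append hxy.2)
  have hzne : [z, y₂] ≠ mm := by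
    rintro rfl
    refine hdesc ?_
    have := hinc'
    simp only [edgeLabels, List.length_cons, List.length_nil, zero_add, List.range_succ] at this
    simp [hlen₁] at this
    simpa [edgeLabels, hm, add_assoc] using this
  have hzch : SatChain x₂ [z, y₂] y₂ := ⟨hz, hzy, rfl⟩
  have hc₂ := ((hrx.append h1).append hmm').append (h2.append hxy.2)
  have hc₃ := ((hrx.append h1).append hzch).append (h2.append hxy.2)
  have hlen := hpure _ _ hc₂ hc₃
  have hy₂ : y₂ ∈ mm := hmm'.end_mem (by rintro rfl; simp at hlen; omega)
  refine ⟨_, z, hc₂, ?_, ?_, ?_, ?_, ?_⟩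
  · have := hlab.1.lex_of_lex hc₂ hc₃ hc₃ (by simp at hlen ⊢; omega) (huniq _ hzch hzne).2
    rw [hm]
    simpa using this
  · simp [hzm]
  · rintro rfl
    exact hzy.lt.not_ge le_top
  · have hzr : z ∉ r := by
      have := hc.nodup
      simp only [List.append_assoc] at this
      intro hzr
      exact (List.disjoint_of_nodup_append this) hzr (by simp)
    rw [List.mem_append]
    exact not_or.2 ⟨hzr, hm₀ z hzm⟩
  · intro b hb hbz
    rw [hm] at hb
    simp only [List.append_assoc, List.mem_append, List.mem_cons, List.cons_append] at hb ⊢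
    rcases hb with hb | hb | hb | hb | hb | hb
    · simp [hb]
    · simp [hb]
    · exact absurd hb hbz
    · subst hb; simp [hy₂]
    · simp [hb]
    · simp [hb]

end Shelling

section OrderComplex

variable {Q V : Type*} [PartialOrder Q] [PartialOrder V]

/-- The order complex of the proper part of a CL-shellable poset `Q`, given here as (the order dual
of) a poset `V`, is shellable. -/
theorem IsCLShellable.isShellable_chainComplex (hQ : IsCLShellable Q) (φ : V → Q)
    (hφ : ∀ a b, φ a ≤ φ b ↔ b ≤ a)
    (hrange : ∀ q, q ∈ Set.range φ ↔ ¬ IsBot q ∧ ¬ IsTop q) :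
    IsShellable (chainComplex V) := by
  classical
  obtain ⟨_, _, hpure, Λ, _, lab, hlab⟩ := hQ
  have hinj : Function.Injective φ := fun a b h =>
    le_antisymm ((hφ b a).1 h.ge) ((hφ a b).1 h.le)
  have : Finite V := Finite.of_injective φ hinj
  have := Fintype.ofFinite V
  have hφbot : ∀ v, ⊥ < φ v := fun v =>
    bot_lt_iff_ne_bot.2 fun h => ((hrange _).1 ⟨v, rfl⟩).1 (h ▸ isBot_bot)
  have hφtop : ∀ v, φ v ≠ ⊤ := fun v h => ((hrange _).1 ⟨v, rfl⟩).2 (h ▸ isTop_top)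
  have hφsurj : ∀ q : Q, q ≠ ⊥ → q ≠ ⊤ → ∃ v, φ v = q := fun q h h' =>
    (hrange q).2 ⟨fun hb => h (le_bot_iff.1 (hb _)), fun ht => h' (top_le_iff.1 (ht _))⟩
  have hempty : ∅ ∈ chainComplex V := fun a ha => absurd ha (Finset.notMem_empty a)
  -- The facet of a maximal chain is its proper part: `c` never lists `⊥`, and `⊤` is not in the
  -- range of `φ`.
  let F : List Q → Finset V := fun c => Finset.univ.filter fun v => φ v ∈ c
  have hmemF : ∀ c v, v ∈ F c ↔ φ v ∈ c := fun c v => by simp [F]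
  have hchain : ∀ c, SatChain ⊥ c ⊤ → F c ∈ chainComplex V := by
    intro c hc a ha b hb _
    have ha' := (hmemF _ _).1 ha
    have hb' := (hmemF _ _).1 hb
    have hp : c.Pairwise fun x y => x ≤ y ∨ y ≤ x := hc.pairwise.imp fun h => Or.inl h.le
    have := hp.forall_of_forall_of_flip (R := fun x y => x ≤ y ∨ y ≤ x)
      (fun _ _ => Or.inl le_rfl) (hp.imp Or.symm) ha' hb'
    rw [hφ, hφ] at this
    exact this.symm
  have hcard : ∀ c, SatChain ⊥ c ⊤ → (F c).card = c.length - 1 := by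
    intro c hc
    have himg : (F c).map ⟨φ, hinj⟩ = c.toFinset.erase ⊤ := by
      ext q
      simp only [Finset.mem_map, hmemF, Function.Embedding.coeFn_mk, Finset.mem_erase,
        List.mem_toFinset]
      constructor
      · rintro ⟨v, hv, rfl⟩
        exact ⟨hφtop v, hv⟩
      · rintro ⟨hq, hqc⟩
        obtain ⟨v, rfl⟩ := hφsurj q (hc.lt_of_mem hqc).ne' hq
        exact ⟨v, hqc, rfl⟩
    rw [← Finset.card_map, himg, ← List.toFinset_card_of_nodup hc.nodup]
    by_cases h : c = []
    · simp [h]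
    · exact Finset.card_erase_of_mem (by simpa using hc.end_mem h)
  have hext : ∀ G ∈ chainComplex V, ∃ c, SatChain ⊥ c ⊤ ∧ G ⊆ F c := by
    intro G hG
    obtain ⟨c, hc, hmem⟩ := exists_satChain_of_isChain (bot_le : (⊥ : Q) ≤ ⊤)
      (G.map ⟨φ, hinj⟩) (by
        rintro _ ha _ hb _
        obtain ⟨a, ha', rfl⟩ := Finset.mem_map.1 ha
        obtain ⟨b, hb', rfl⟩ := Finset.mem_map.1 hb
        have := IsChain.total hG (Finset.mem_coe.2 ha') (Finset.mem_coe.2 hb')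
        rw [← hφ, ← hφ] at this
        exact this.symm) (fun _ _ => ⟨bot_le, le_top⟩)
    exact ⟨c, hc, fun v hv => (hmemF _ _).2
      (hmem _ (Finset.mem_map_of_mem _ hv) (hφbot v))⟩
  have hfacet : ∀ G, IsFacet (chainComplex V) G ↔ ∃ c, SatChain ⊥ c ⊤ ∧ F c = G := by
    intro G
    constructor
    · intro hG
      obtain ⟨c, hc, hGc⟩ := hext G hG.1
      exact ⟨c, hc, (hG.eq_of_le (hchain c hc) hGc).symm⟩
    · rintro ⟨c, hc, rfl⟩
      refine ⟨hchain c hc, fun G hG hcG => ?_⟩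
      obtain ⟨c', hc', hGc'⟩ := hext G hG
      have heq : F c = F c' := Finset.eq_of_subset_of_card_le (hcG.trans hGc')
        (by rw [hcard c hc, hcard c' hc', hpure c c' hc hc'])
      rw [heq]
      exact hGc'
  have hFinj : ∀ c c', SatChain ⊥ c ⊤ → SatChain ⊥ c' ⊤ → F c = F c' → c = c' := by
    have hsub : ∀ c c', SatChain ⊥ c ⊤ → SatChain ⊥ c' ⊤ → F c = F c' → c ⊆ c' := by
      intro c c' hc hc' h q hq
      by_cases hqt : q = ⊤
      · subst hqt
        refine hc'.end_mem (List.length_pos_iff.1 ?_)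
        rw [← hpure c c' hc hc']
        exact List.length_pos_of_mem hq
      · obtain ⟨v, rfl⟩ := hφsurj q (hc.lt_of_mem hq).ne' hqt
        rwa [← hmemF, ← h, hmemF]
    intro c c' hc hc' h
    refine List.Perm.eq_of_pairwise (fun a b _ _ h h' => absurd h' h.not_gt) hc.pairwise
      hc'.pairwise ?_
    exact (List.perm_ext_iff_of_nodup hc.nodup hc'.nodup).2 fun q =>
      ⟨fun hq => hsub c c' hc hc' h hq, fun hq => hsub c' c hc' hc h.symm hq⟩
  obtain ⟨c₀, hc₀⟩ := exists_satChain (bot_le : (⊥ : Q) ≤ ⊤)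
  have : Finite {c : List Q // SatChain ⊥ c ⊤} :=
    ((List.finite_length_eq Q c₀.length).subset fun c hc => hpure c c₀ hc hc₀).to_subtype
  let R : {c : List Q // SatChain ⊥ c ⊤} → {c : List Q // SatChain ⊥ c ⊤} → Prop := fun c c' =>
    List.Lex (· < ·) (edgeLabels lab [] c.1 []) (edgeLabels lab [] c'.1 [])
  have : IsStrictOrder _ R :=
    { irrefl := fun c => List.lex_irrefl lt_irrefl _
      trans := fun a b c hab hbc => List.lex_trans (fun h h' => lt_trans h h') hab hbc }
  obtain ⟨t, f, hf⟩ := exists_fin_enumeration R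
  -- The subtraction in ℕ is truncated on purpose: if `Q` is a single point, `c₀` is empty and the
  -- complex `{∅}` has dimension -1.
  refine ⟨Set.toFinite _, ((c₀.length - 1 : ℕ) : ℤ) - 1, ⟨⟨∅, hempty⟩, ?_⟩,
    t, fun i => F (f i).1, fun i j h => f.injective (Subtype.ext
      (hFinj _ _ (f i).2 (f j).2 h)), fun G => ?_, fun k hk => ⟨⟨∅, ?_⟩, fun G hG => ?_⟩⟩
  · intro G hG
    obtain ⟨c, hc, rfl⟩ := (hfacet G).1 hG
    rw [hcard c hc, hpure c c₀ hc hc₀]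
    ring
  · rw [hfacet]
    constructor
    · rintro ⟨c, hc, rfl⟩
      exact ⟨f.symm ⟨c, hc⟩, by simp⟩
    · rintro ⟨i, rfl⟩
      exact ⟨_, (f i).2, rfl⟩
  · simp only [LowerSet.mem_inf_iff, LowerSet.mem_iSup_iff, LowerSet.mem_Iic_iff]
    exact ⟨⟨⟨⟨0, by omega⟩, hk⟩, Finset.empty_subset _⟩, Finset.empty_subset _⟩
  · have hmem : ∀ G, G ∈ ((⨆ i : {i : Fin t // i < k}, LowerSet.Iic (F (f i.val).1)) ⊓
        LowerSet.Iic (F (f k).1)) ↔ (∃ i < k, G ⊆ F (f i).1) ∧ G ⊆ F (f k).1 := by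
      intro G
      simp [LowerSet.mem_inf_iff, LowerSet.mem_iSup_iff, LowerSet.mem_Iic_iff]
    obtain ⟨⟨i, hik, hGi⟩, hGk⟩ := (hmem G).1 hG.1
    obtain ⟨c, z, hc, hlex, hz, hzt, hzi, hcz⟩ := hlab.exchange hpure (f k).2 (f i).2
      (fun h => hik.ne' (f.injective (Subtype.ext h)))
      (fun h => (hf k i h).not_gt hik)
    obtain ⟨v, rfl⟩ := hφsurj z ((f k).2.lt_of_mem hz).ne' hzt
    have hvk : v ∈ F (f k).1 := (hmemF _ _).2 hz
    -- `v` is not in the earlier facet, so `G` avoids it; and `F (f k).1` without `v` lies in the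
    -- facet of `c`, which is also earlier. Maximality of `G` gives equality.
    have hGe : G = (F (f k).1).erase v := by
      refine hG.eq_of_le ((hmem _).2 ⟨⟨f.symm ⟨c, hc⟩, hf _ _ (by rw [Equiv.apply_symm_apply]; exact hlex), ?_⟩,
        Finset.erase_subset _ _⟩) fun a ha => Finset.mem_erase.2 ⟨?_, hGk ha⟩
      · intro a ha
        obtain ⟨hav, ha⟩ := Finset.mem_erase.1 ha
        simp only [Equiv.apply_symm_apply]
        exact (hmemF _ _).2 (hcz _ ((hmemF _ _).1 ha) (hinj.ne hav))
      · rintro rfl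
        exact hzi ((hmemF _ _).1 (hGi ha))
    have hpos := Finset.card_pos.2 ⟨v, hvk⟩
    rw [hGe, Finset.card_erase_of_mem hvk, Nat.cast_sub hpos, hcard _ (f k).2,
      hpure _ c₀ (f k).2 hc₀]
    push_cast
    ring

end OrderComplex

/-! ### Intervals of the subword order -/

section Subword

open List

theorem List.Sublist.exists_sublist_eraseIdx {α : Type*} {y x : List α} (h : y <+ x) (hne : y ≠ x) :
    ∃ i < x.length, y <+ x.eraseIdx i := by
  induction h with
  | slnil => exact absurd rfl hne
  | cons a h _ => exact ⟨0, by simp, by simpa using h⟩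
  | cons_cons a h ih =>
    obtain ⟨i, hi, h'⟩ := ih (fun e => hne (by rw [e]))
    exact ⟨i + 1, by simpa using hi, by simpa using h'⟩

/-- If a subword `y` of `x` can be reached by deleting the letter at `i` or by deleting one further
left, and the letter at `i` is the first one of its run, then after deleting it one can still
delete a letter to the left of it. -/
theorem List.Sublist.exists_eraseIdx_eraseIdx {α : Type*} {x y : List α} {i k : ℕ} (hki : k < i)
    (hi : i < x.length) (hyi : y <+ x.eraseIdx i) (hyk : y <+ x.eraseIdx k)
    (hrun : x.eraseIdx (i - 1) ≠ x.eraseIdx i) :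
    ∃ j < i, y <+ (x.eraseIdx i).eraseIdx j := by
  obtain ⟨i, rfl⟩ : ∃ i', i = i' + 1 := ⟨i - 1, by omega⟩
  obtain ⟨A, l, c, R, rfl, rfl⟩ : ∃ A l c R, x = A ++ l :: c :: R ∧ A.length = i :=
    ⟨x.take i, x[i], x[i + 1], x.drop (i + 2), by simp, by simp; omega⟩
  have h1 : (A ++ l :: c :: R).eraseIdx (A.length + 1) = (A ++ [l]) ++ R := by
    rw [List.eraseIdx_append_of_length_le (by omega)]; simp
  have h0 : (A ++ l :: c :: R).eraseIdx A.length = A ++ c :: R := by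
    rw [List.eraseIdx_append_of_length_le (by omega)]; simp
  have hlc : l ≠ c := by
    rintro rfl
    exact hrun (by rw [h1, Nat.add_sub_cancel, h0]; simp)
  rw [h1] at hyi ⊢
  obtain ⟨y₁, z, rfl, hy₁, hz⟩ := List.sublist_append_iff.1 hyi
  -- If `y₁` is a proper subword of `A ++ [l]`, a letter of that prefix can be spared. Otherwise the
  -- embedding into the deletion at `k`, read after `A.length` letters, puts `l :: z` into `c :: R`;
  -- as `l ≠ c`, it lies in `R`, and `l` itself can be spared.
  by_cases hne : y₁ = A ++ [l]
  · refine ⟨A.length, by omega, ?_⟩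
    subst hne
    have hd := hyk.drop A.length
    have h2 : ((A ++ l :: c :: R).eraseIdx k).drop A.length = c :: R := by
      have : (A ++ l :: c :: R).eraseIdx k = (A ++ [l]).eraseIdx k ++ c :: R := by
        rw [← List.eraseIdx_append_of_lt_length (by simp; omega)]; simp
      rw [this]
      exact List.drop_left' (by rw [List.length_eraseIdx]; simp; omega)
    rw [h2] at hd
    simp only [List.append_assoc, List.singleton_append, List.drop_left] at hd
    have hlz : l :: z <+ R := by
      cases hd with
      | cons _ h => exact h
      | cons_cons => exact absurd rfl hlc
    rw [List.append_assoc, List.append_assoc, List.eraseIdx_append_of_length_le le_rfl]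
    simpa using hlz
  · obtain ⟨j, hj, h⟩ := hy₁.exists_sublist_eraseIdx hne
    refine ⟨j, by simpa using hj, ?_⟩
    rw [List.eraseIdx_append_of_lt_length hj]
    exact h.append hz

/-- The leftmost index at which a letter of `x` can be deleted to obtain `y`. -/
noncomputable def delIdx {α : Type*} (x y : List α) : ℕ := sInf {i | x.eraseIdx i = y}

theorem delIdx_le {α : Type*} {x y : List α} {i : ℕ} (h : x.eraseIdx i = y) : delIdx x y ≤ i :=
  Nat.sInf_le h

theorem eraseIdx_delIdx {α : Type*} {x y : List α} {i : ℕ} (h : x.eraseIdx i = y) :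
    x.eraseIdx (delIdx x y) = y :=
  Nat.sInf_mem (s := {i | x.eraseIdx i = y}) ⟨i, h⟩

/-- The original positions of the letters deleted along a chain of words starting with `x`, where
`ps` lists the original positions of the letters of `x`. -/
noncomputable def delLabels {α : Type*} : List α → List ℕ → List (List α) → List ℕ
  | _, _, [] => []
  -- The default 0 is never reached when `y` is a one-letter deletion of `x` and `ps` is as long as
  -- `x`.
  | x, ps, y :: c => ps.getD (delIdx x y) 0 :: delLabels y (ps.eraseIdx (delIdx x y)) c

/-- The original positions of the letters which are left at the end of a chain of words. -/
noncomputable def delRest {α : Type*} : List α → List ℕ → List (List α) → List ℕ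
  | _, ps, [] => ps
  | x, ps, y :: c => delRest y (ps.eraseIdx (delIdx x y)) c

@[simp] theorem length_delLabels {α : Type*} (x : List α) (ps : List ℕ) (c : List (List α)) :
    (delLabels x ps c).length = c.length := by
  induction c generalizing x ps with
  | nil => rfl
  | cons y c ih => simp [delLabels, ih]

theorem take_delLabels {α : Type*} (x : List α) (ps : List ℕ) (c : List (List α)) (d : ℕ) :
    (delLabels x ps c).take d = delLabels x ps (c.take d) := by
  induction c generalizing x ps d with
  | nil => simp [delLabels]
  | cons y c ih => cases d <;> simp [delLabels, ih]

theorem delRest_sublist {α : Type*} (x : List α) (ps : List ℕ) (c : List (List α)) :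
    delRest x ps c <+ ps := by
  induction c generalizing x ps with
  | nil => exact .refl _
  | cons y c ih => exact (ih _ _).trans (List.eraseIdx_sublist _ _)

variable {P α : Type*} [PartialOrder P] {word : P → List α}

theorem delLabels_append_of_satChain {x y : P} {r : List P} (h : SatChain x r y) (ps : List ℕ)
    (m : List P) :
    delLabels (word x) ps ((r ++ m).map word) =
      delLabels (word x) ps (r.map word) ++
        delLabels (word y) (delRest (word x) ps (r.map word)) (m.map word) := by
  induction r generalizing x ps with
  | nil => rw [show x = y from h]; rfl
  | cons a r ih => simp [delLabels, delRest, ← ih h.2]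

theorem injective_of_le_iff_sublist (hle : ∀ a b, a ≤ b ↔ word b <+ word a) :
    Function.Injective word := fun a b h =>
  le_antisymm ((hle a b).2 (h ▸ .refl _)) ((hle b a).2 (h ▸ .refl _))

variable [BoundedOrder P]

theorem exists_word_eq_eraseIdx (hle : ∀ a b, a ≤ b ↔ word b <+ word a)
    (hsurj : ∀ v, word ⊤ <+ v → v <+ word ⊥ → ∃ p, word p = v) {x y : P} {i : ℕ}
    (hi : i < (word x).length) (h : word y <+ (word x).eraseIdx i) :
    ∃ z, word z = (word x).eraseIdx i ∧ x ⋖ z ∧ z ≤ y := by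
  obtain ⟨z, hz⟩ := hsurj _ (((hle _ _).1 le_top).trans h)
    ((List.eraseIdx_sublist _ _).trans ((hle _ _).1 bot_le))
  have hlen : (word z).length + 1 = (word x).length := by
    rw [hz, List.length_eraseIdx_of_lt hi]; omega
  refine ⟨z, hz, ⟨lt_of_le_of_ne ((hle _ _).2 (hz ▸ List.eraseIdx_sublist _ _)) ?_, ?_⟩,
    (hle _ _).2 (hz ▸ h)⟩
  · rintro rfl; omega
  · intro b hxb hbz
    have h1 := (hle _ _).1 hxb.le
    have h2 := (hle _ _).1 hbz.le
    rcases h1.length_le.eq_or_lt with h | h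
    · exact hxb.ne (injective_of_le_iff_sublist hle (h1.eq_of_length h).symm)
    · exact hbz.ne (injective_of_le_iff_sublist hle (h2.eq_of_length_le (by omega)).symm)

/-- A proper subword survives the deletion of some letter, and the resulting word belongs to a cover
of `x` below `z`, which must be `z`. Hence covers are exactly one-letter deletions, and purity
follows by counting letters. -/
theorem CovBy.eraseIdx_delIdx_word (hle : ∀ a b, a ≤ b ↔ word b <+ word a)
    (hsurj : ∀ v, word ⊤ <+ v → v <+ word ⊥ → ∃ p, word p = v) {x z : P} (h : x ⋖ z) :
    (word x).eraseIdx (delIdx (word x) (word z)) = word z ∧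
      delIdx (word x) (word z) < (word x).length := by
  obtain ⟨i, hi, hs⟩ := ((hle _ _).1 h.le).exists_sublist_eraseIdx
    (fun e => h.ne (injective_of_le_iff_sublist hle e.symm))
  obtain ⟨z', hz', hxz', hzz'⟩ := exists_word_eq_eraseIdx hle hsurj hi hs
  obtain rfl : z' = z := by
    rcases hzz'.eq_or_lt with e | hlt
    · exact e
    · exact absurd hlt (h.2 hxz'.lt)
  exact ⟨eraseIdx_delIdx hz'.symm, (delIdx_le hz'.symm).trans_lt hi⟩

theorem SatChain.length_word (hle : ∀ a b, a ≤ b ↔ word b <+ word a)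
    (hsurj : ∀ v, word ⊤ <+ v → v <+ word ⊥ → ∃ p, word p = v) {x y : P} {c : List P}
    (h : SatChain x c y) : (word x).length = (word y).length + c.length := by
  induction c generalizing x with
  | nil => rw [show x = y from h]; rfl
  | cons a c ih =>
    obtain ⟨h1, h2⟩ := h.1.eraseIdx_delIdx_word hle hsurj
    have := ih h.2
    rw [← h1, List.length_eraseIdx_of_lt h2] at this
    simp; omega

theorem SatChain.length_delRest (hle : ∀ a b, a ≤ b ↔ word b <+ word a)
    (hsurj : ∀ v, word ⊤ <+ v → v <+ word ⊥ → ∃ p, word p = v) {x y : P} {c : List P}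
    (h : SatChain x c y) {ps : List ℕ} (hps : ps.length = (word x).length) :
    (delRest (word x) ps (c.map word)).length = (word y).length := by
  induction c generalizing x ps with
  | nil => rw [show x = y from h] at hps; exact hps
  | cons a c ih =>
    obtain ⟨h1, h2⟩ := h.1.eraseIdx_delIdx_word hle hsurj
    refine ih h.2 ?_
    conv_rhs => rw [← h1]
    rw [List.length_eraseIdx, List.length_eraseIdx, hps]

theorem List.getD_eraseIdx_of_lt {ps : List ℕ} {i j : ℕ} (h : j < i) :
    (ps.eraseIdx i).getD j 0 = ps.getD j 0 := by
  simp [List.getD_eq_getElem?_getD, List.getElem?_eraseIdx, h]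

theorem List.getD_eraseIdx_of_ge {ps : List ℕ} {i j : ℕ} (h : i ≤ j) :
    (ps.eraseIdx i).getD j 0 = ps.getD (j + 1) 0 := by
  simp [List.getD_eq_getElem?_getD, List.getElem?_eraseIdx, not_lt.2 h]

theorem List.Pairwise.getD_lt {ps : List ℕ} (hps : ps.Pairwise (· < ·)) {i j : ℕ} (h : i < j)
    (hj : j < ps.length) : ps.getD i 0 < ps.getD j 0 := by
  rw [List.getD_eq_getElem _ _ hj, List.getD_eq_getElem _ _ (h.trans hj)]
  exact List.pairwise_iff_getElem.1 hps _ _ _ _ h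

theorem List.eraseIdx_eraseIdx_sublist {j k : ℕ} (h : j < k) (l : List α) :
    (l.eraseIdx k).eraseIdx j <+ l.eraseIdx j := by
  induction l generalizing j k with
  | nil => simp
  | cons a l ih =>
    obtain ⟨k, rfl⟩ : ∃ k', k = k' + 1 := ⟨k - 1, by omega⟩
    cases j with
    | zero => simpa using List.eraseIdx_sublist l k
    | succ j => simpa using ih (by omega : j < k)

/-- The chain which always deletes the leftmost letter that can be deleted is the only one with
increasing labels, and it is lexicographically first. -/
theorem exists_increasing_satChain (hle : ∀ a b, a ≤ b ↔ word b <+ word a)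
    (hsurj : ∀ v, word ⊤ <+ v → v <+ word ⊥ → ∃ p, word p = v) {x y : P} (hxy : x ≤ y)
    {ps : List ℕ} (hps : ps.Pairwise (· < ·)) (hlen : ps.length = (word x).length) :
    ∃ m, SatChain x m y ∧ (delLabels (word x) ps (m.map word)).IsChain (· < ·) ∧
      (∀ a l, m = a :: l → ∀ j < (word x).length, word y <+ (word x).eraseIdx j →
        delIdx (word x) (word a) ≤ j) ∧
      ∀ m', SatChain x m' y → m' ≠ m →
        ¬ (delLabels (word x) ps (m'.map word)).IsChain (· < ·) ∧
        List.Lex (· < ·) (delLabels (word x) ps (m.map word))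
          (delLabels (word x) ps (m'.map word)) := by
  classical
  induction hn : (word x).length generalizing x ps with
  | zero =>
    have hy : y = x := by
      have h1 : word x = [] := List.length_eq_zero_iff.1 hn
      have h2 := (hle _ _).1 hxy
      rw [h1] at h2
      exact injective_of_le_iff_sublist hle (by rw [h1, List.sublist_nil.1 h2])
    subst hy
    exact ⟨[], rfl, by simp [delLabels], by simp, fun m' h' hne => absurd h'.eq_nil hne⟩
  | succ n ih =>
    rcases hxy.eq_or_lt with rfl | hlt
    · exact ⟨[], rfl, by simp [delLabels], by simp, fun m' h' hne => absurd h'.eq_nil hne⟩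
    have hex := ((hle _ _).1 hlt.le).exists_sublist_eraseIdx
      (fun e => hlt.ne (injective_of_le_iff_sublist hle e.symm))
    obtain ⟨hk, hky⟩ := Nat.find_spec hex
    have hmin : ∀ j < (word x).length, word y <+ (word x).eraseIdx j → Nat.find hex ≤ j :=
      fun j h1 h2 => Nat.find_min' hex ⟨h1, h2⟩
    generalize Nat.find hex = k at hk hky hmin
    have step : ∀ z, x ⋖ z → ((ps.eraseIdx (delIdx (word x) (word z))).Pairwise (· < ·)) ∧
        (ps.eraseIdx (delIdx (word x) (word z))).length = (word z).length ∧
        (word z).length = n := by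
      intro z hz
      obtain ⟨h1, h2⟩ := hz.eraseIdx_delIdx_word hle hsurj
      refine ⟨hps.sublist (List.eraseIdx_sublist _ _), ?_, ?_⟩
      · conv_rhs => rw [← h1]
        rw [List.length_eraseIdx, List.length_eraseIdx, hlen]
      · rw [← h1, List.length_eraseIdx_of_lt h2]; omega
    obtain ⟨x₁, hx₁, hcov, hx₁y⟩ := exists_word_eq_eraseIdx hle hsurj hk hky
    have hkdel : delIdx (word x) (word x₁) = k := by
      obtain ⟨h1, h2⟩ := hcov.eraseIdx_delIdx_word hle hsurj
      refine le_antisymm (delIdx_le hx₁.symm) (hmin _ h2 ?_)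
      rw [h1, hx₁]; exact hky
    obtain ⟨s1, s2, s3⟩ := step x₁ hcov
    obtain ⟨m₁, hm₁, hinc₁, -, huniq₁⟩ := ih hx₁y s1 s2 s3
    refine ⟨x₁ :: m₁, ⟨hcov, hm₁⟩, ?_, ?_, ?_⟩
    · simp only [List.map_cons, delLabels]
      cases m₁ with
      | nil => simp [delLabels]
      | cons x₂ m₂ =>
        simp only [List.map_cons, delLabels] at hinc₁ ⊢
        refine List.isChain_cons_cons.2 ⟨?_, hinc₁⟩
        obtain ⟨h1, h2⟩ := hm₁.1.eraseIdx_delIdx_word hle hsurj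
        -- A letter deletable to the left of `k` in `word x₁` could already have been deleted from
        -- `word x`, contradicting the minimality of `k`.
        have hle2 : k ≤ delIdx (word x₁) (word x₂) := by
          by_contra! hcon
          have h3 := (hle _ _).1 hm₁.2.le
          rw [← h1, hx₁] at h3
          refine absurd (hmin (delIdx (word x₁) (word x₂)) (hcon.trans hk) ?_) (not_le.2 hcon)
          rw [hx₁] at hcon ⊢
          exact h3.trans (List.eraseIdx_eraseIdx_sublist hcon _)
        -- Indices from `k` on have shifted by one, so even deleting again at index `k` gives a
        -- strictly larger label.
        rw [hkdel, List.getD_eraseIdx_of_ge hle2]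
        exact hps.getD_lt (by omega) (by omega)
    · rintro a l h j hj hyj
      obtain ⟨rfl, -⟩ := List.cons.inj h
      rw [hkdel]
      exact hmin j (by omega) hyj
    · intro m' hm' hne
      match m', hm' with
      | [], hm' => exact absurd hm' hlt.ne
      | z :: m'', hm' =>
        obtain ⟨h1, h2⟩ := hm'.1.eraseIdx_delIdx_word hle hsurj
        have hyz := (hle _ _).1 hm'.2.le
        have hki := hmin _ h2 (by rw [h1]; exact hyz)
        simp only [List.map_cons, delLabels]
        rcases hki.eq_or_lt with heq | hgt
        · obtain rfl : x₁ = z := injective_of_le_iff_sublist hle (by rw [hx₁, ← h1, heq])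
          obtain ⟨h3, h4⟩ := huniq₁ m'' hm'.2 (by rintro rfl; exact hne rfl)
          exact ⟨fun h => h3 h.tail, .cons h4⟩
        · refine ⟨fun hinc => ?_, .rel ?_⟩
          -- An increasing chain through `z` continues with the greedy chain of `[z, y]`. A letter
          -- left of the one just deleted can still be spared, so the greedy chain deletes one there
          -- next, and the label drops.
          · obtain ⟨t1, t2, t3⟩ := step z hm'.1
            obtain ⟨mz, hmz, -, hgreedy, huniq⟩ := ih hm'.2.le t1 t2 t3
            obtain rfl : m'' = mz := by
              by_contra h
              exact (huniq m'' hm'.2 h).1 hinc.tail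
            obtain ⟨j, hj, hyj⟩ := List.Sublist.exists_eraseIdx_eraseIdx hgt h2
              (by rw [h1]; exact hyz) hky (by
                intro e
                rw [h1] at e
                have := delIdx_le e
                omega)
            rw [h1] at hyj
            cases m'' with
            | nil =>
              rw [show z = y from hmz] at hyj t3
              have := hyj.length_le
              rw [List.length_eraseIdx, t3] at this
              split at this <;> omega
            | cons a l =>
              have ha := hgreedy a l rfl j (by omega) hyj
              simp only [List.map_cons, delLabels] at hinc
              have h5 := (List.isChain_cons_cons.1 hinc).1
              rw [List.getD_eraseIdx_of_lt (by omega)] at h5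
              exact absurd h5 (not_lt.2 (hps.getD_lt (by omega) (by omega)).le)
          · rw [hkdel]
            exact hps.getD_lt hgt (by omega)

/-- An interval of the subword order, turned upside down, is CL-shellable. -/
theorem isCLShellable_of_le_iff_sublist (hle : ∀ a b, a ≤ b ↔ word b <+ word a)
    (hsurj : ∀ v, word ⊤ <+ v → v <+ word ⊥ → ∃ p, word p = v) : IsCLShellable P := by
  have hfin : Finite P := by
    have : Finite {v // v ∈ (word ⊥).sublists} := List.finite_toSet _
    refine Finite.of_injective
      (fun p => (⟨word p, List.mem_sublists.2 ((hle _ _).1 bot_le)⟩ : {v // v ∈ (word ⊥).sublists}))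
      fun a b h => injective_of_le_iff_sublist hle (congrArg Subtype.val h)
  refine ⟨hfin, inferInstance, fun c c' hc hc' => ?_, ℕ, inferInstance,
    fun c i => (delLabels (word ⊥) (List.range (word ⊥).length) (c.map word)).getD i 0, ?_, ?_⟩
  · have h1 := hc.length_word hle hsurj
    have h2 := hc'.length_word hle hsurj
    omega
  · intro c c' _ _ d hd i hi
    have h : (c.map word).take d = (c'.map word).take d := by
      rw [← List.map_take, ← List.map_take, hd]
    have key : ∀ l : List ℕ, l.getD i 0 = (l.take d).getD i 0 := by
      intro l
      simp [List.getD_eq_getElem?_getD, hi]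
    beta_reduce
    rw [key, key (delLabels _ _ (c'.map word)), take_delLabels, take_delLabels, h]
  · intro x y r t hxy hr ht
    -- The root `r` influences the later labels only through the original positions it leaves
    -- undeleted.
    set ps := delRest (word ⊥) (List.range (word ⊥).length) (r.map word) with hps
    have hedge : ∀ m, SatChain x m y → edgeLabels (fun c i =>
        (delLabels (word ⊥) (List.range (word ⊥).length) (c.map word)).getD i 0) r m t =
        delLabels (word x) ps (m.map word) := by
      intro m hm
      refine List.ext_getElem (by simp [edgeLabels]) fun i h1 h2 => ?_
      simp only [edgeLabels, List.getElem_map, List.getElem_range, List.append_assoc]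
      rw [delLabels_append_of_satChain hr, ← hps, delLabels_append_of_satChain hm]
      have hi : i < m.length := by simpa using h2
      rw [List.getD_append_right _ _ _ _ (by simp), List.getD_append _ _ _ _ (by simpa using hi)]
      simp [hi]
    obtain ⟨m, hm, h1, -, h3⟩ := exists_increasing_satChain hle hsurj hxy (ps := ps)
      (List.pairwise_lt_range.sublist (delRest_sublist _ _ _)) (hr.length_delRest hle hsurj (by simp))
    refine ⟨m, hm, by rwa [hedge m hm], fun m' hm' hne => ?_⟩
    rw [hedge m hm, hedge m' hm']
    exact h3 m' hm' hne

end Subword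

/-! ### Permutations with a fixed number of descents as words -/

namespace Permutation

/-- There is a descent at position `i`. -/
def IsDescent (π : Permutation) (i : ℕ) : Prop :=
  ∃ h : i + 1 < π.length, π.letter ⟨i + 1, h⟩ < π.letter ⟨i, by omega⟩

/-- The number of descents before position `i`: the index of the ascending run through `i`. -/
noncomputable def run (π : Permutation) (i : ℕ) : ℕ :=
  @Nat.count π.IsDescent (Classical.decPred _) i

/-- The word whose `v`-th letter is the index of the ascending run of `π` that contains `v`. -/
noncomputable def word (π : Permutation) : List ℕ :=
  List.ofFn fun v : Fin π.length => π.run (π.letter.symm v)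

theorem run_mono (π : Permutation) : Monotone π.run := by
  classical
  exact Nat.count_monotone _

theorem run_succ_of_isDescent {π : Permutation} {i : ℕ} (h : π.IsDescent i) :
    π.run (i + 1) = π.run i + 1 := by
  classical
  simp [run, Nat.count_succ, h]

theorem run_succ_of_not_isDescent {π : Permutation} {i : ℕ} (h : ¬ π.IsDescent i) :
    π.run (i + 1) = π.run i := by
  classical
  simp [run, Nat.count_succ, h]

theorem run_length (π : Permutation) : π.run π.length = π.des := by
  classical
  rw [run, Nat.count_eq_card_filter_range, des, ← Nat.card_eq_finsetCard]
  exact Nat.card_congr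
    { toFun := fun i => ⟨⟨i.1, Finset.mem_range.1 (Finset.mem_filter.1 i.2).1⟩,
        (Finset.mem_filter.1 i.2).2⟩
      invFun := fun i => ⟨i.1.1, Finset.mem_filter.2 ⟨Finset.mem_range.2 i.1.2, i.2⟩⟩
      left_inv := fun _ => rfl
      right_inv := fun _ => rfl }

theorem run_le_des {π : Permutation} {i : ℕ} (hi : i ≤ π.length) : π.run i ≤ π.des :=
  (π.run_mono hi).trans π.run_length.le

theorem des_eq_run_of_succ_eq {π : Permutation} {i : ℕ} (hi : i + 1 = π.length) :
    π.des = π.run i := by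
  rw [← run_length, ← hi]
  exact run_succ_of_not_isDescent fun ⟨h, _⟩ => by omega

/-- `g` is nondecreasing along the positions of `π`, and constant only along ascending stretches. -/
def IsRunLabeling (π : Permutation) (g : Fin π.length → ℕ) : Prop :=
  Monotone g ∧ ∀ i j, i < j → g i = g j → π.letter i < π.letter j

theorem isRunLabeling_run (π : Permutation) : π.IsRunLabeling fun i => π.run i := by
  refine ⟨fun i j h => π.run_mono h, fun i j hij h => ?_⟩
  obtain ⟨i, hi⟩ := i
  obtain ⟨j, hj⟩ := j
  simp only [Fin.mk_lt_mk] at hij h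
  induction j, hij using Nat.le_induction with
  | base =>
    by_contra hlt
    have hd : π.IsDescent i := ⟨hj, lt_of_le_of_ne (not_lt.1 hlt) (by simp)⟩
    have := run_succ_of_isDescent hd
    simp only [Nat.succ_eq_add_one] at h
    omega
  | succ j hij ih =>
    have h1 : π.run i ≤ π.run j := π.run_mono (by omega)
    have h2 : π.run j ≤ π.run (j + 1) := π.run_mono (by omega)
    refine (ih (by omega) (by omega)).trans ?_
    by_contra hlt
    have hd : π.IsDescent j := ⟨hj, lt_of_le_of_ne (not_lt.1 hlt) (by simp)⟩
    have := run_succ_of_isDescent hd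
    omega

/-- Each descent forces `g` to increase, so `g - run` is nondecreasing; the additive form avoids
subtraction in ℕ. -/
theorem IsRunLabeling.run_add_le {π : Permutation} {g : Fin π.length → ℕ} (hg : π.IsRunLabeling g)
    {i j : Fin π.length} (hij : i ≤ j) : g i + π.run j ≤ g j + π.run i := by
  obtain ⟨i, hi⟩ := i
  obtain ⟨j, hj⟩ := j
  simp only [Fin.mk_le_mk] at hij
  induction j, hij using Nat.le_induction with
  | base => exact le_rfl
  | succ j hij ih =>
    have ih := ih (by omega)
    simp only at ih ⊢
    have hm : g ⟨j, by omega⟩ ≤ g ⟨j + 1, hj⟩ := hg.1 (by simp)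
    by_cases hd : π.IsDescent j
    · have hne : g ⟨j, by omega⟩ ≠ g ⟨j + 1, hj⟩ := fun h =>
        (hg.2 _ _ (by simp) h).not_gt hd.2
      rw [run_succ_of_isDescent hd]
      omega
    · rw [run_succ_of_not_isDescent hd]
      omega

theorem IsRunLabeling.des_le {π : Permutation} {g : Fin π.length → ℕ} (hg : π.IsRunLabeling g)
    {d : ℕ} (hd : ∀ i, g i ≤ d) : π.des ≤ d := by
  rcases Nat.eq_zero_or_pos π.length with h0 | hpos
  · rw [← run_length, h0]
    simp [run]
  · have h := hg.run_add_le (i := ⟨0, hpos⟩) (j := ⟨π.length - 1, by omega⟩) (by simp)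
    have h1 := hd ⟨π.length - 1, by omega⟩
    have h2 := des_eq_run_of_succ_eq (π := π) (i := π.length - 1) (by omega)
    have h3 : π.run 0 = 0 := by simp [run]
    simp only [h3] at h
    omega

/-- The only run labeling with values in `{0, …, des π}` is the run index. -/
theorem IsRunLabeling.eq_run {π : Permutation} {g : Fin π.length → ℕ} (hg : π.IsRunLabeling g)
    (hd : ∀ i, g i ≤ π.des) (i : Fin π.length) : g i = π.run i := by
  have hpos : 0 < π.length := i.pos
  -- The nondecreasing difference `g - run` is at least 0 at the first position and at most 0 at the
  -- last, so it vanishes.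
  have h := hg.run_add_le (i := ⟨0, hpos⟩) (j := i) (by simp [Fin.le_def])
  have h' := hg.run_add_le (i := i) (j := ⟨π.length - 1, by omega⟩) (by
    rw [Fin.le_def]
    have := i.2
    simp only
    omega)
  have h1 := hd ⟨π.length - 1, by omega⟩
  have h2 := des_eq_run_of_succ_eq (π := π) (i := π.length - 1) (by omega)
  have h3 : π.run 0 = 0 := by simp [run]
  simp only [h3] at h h'
  omega

theorem IsRunLabeling.comp {σ π : Permutation} {g : Fin π.length → ℕ} (hg : π.IsRunLabeling g)
    (e : Fin σ.length ↪o Fin π.length)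
    (he : ∀ i j, σ.letter i < σ.letter j ↔ π.letter (e i) < π.letter (e j)) :
    σ.IsRunLabeling (g ∘ e) :=
  ⟨hg.1.comp e.monotone, fun i j hij h => (he i j).2 (hg.2 _ _ (e.strictMono hij) h)⟩

/-- The run index of `π`, pulled back along an occurrence of `σ`, is a run labeling of `σ` bounded
by `π.des`. -/
theorem des_mono {σ π : Permutation} (h : σ ≤ π) : σ.des ≤ π.des := by
  obtain ⟨e, he⟩ := h
  exact (π.isRunLabeling_run.comp e he).des_le fun i => run_le_des (e i).2.le

/-- The word of a permutation with respect to a run labeling. -/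
def labelWord (π : Permutation) (g : Fin π.length → ℕ) : List ℕ :=
  List.ofFn fun v => g (π.letter.symm v)

theorem labelWord_sublist_labelWord_iff {σ π : Permutation} {g : Fin σ.length → ℕ}
    {h : Fin π.length → ℕ} : (σ.labelWord g).Sublist (π.labelWord h) ↔
      ∃ f : Fin σ.length ↪o Fin π.length,
        ∀ v, g (σ.letter.symm v) = h (π.letter.symm (f v)) := by
  rw [List.sublist_iff_exists_fin_orderEmbedding_get_eq]
  have h1 : (σ.labelWord g).length = σ.length := by simp [labelWord]
  have h2 : (π.labelWord h).length = π.length := by simp [labelWord]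
  constructor
  · rintro ⟨f, hf⟩
    refine ⟨((Fin.castOrderIso h1.symm).toOrderEmbedding.trans f).trans
      (Fin.castOrderIso h2).toOrderEmbedding, fun v => ?_⟩
    have := hf (Fin.cast h1.symm v)
    simp only [labelWord, List.get_ofFn] at this
    exact this
  · rintro ⟨f, hf⟩
    refine ⟨((Fin.castOrderIso h1).toOrderEmbedding.trans f).trans
      (Fin.castOrderIso h2.symm).toOrderEmbedding, fun v => ?_⟩
    rw [List.get_eq_getElem, List.get_eq_getElem]
    simp only [labelWord, List.getElem_ofFn]
    exact hf (Fin.cast h1 v)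

/-- A subword embedding `f` acts on values and preserves labels. Conjugated to positions it is
increasing: across labels by monotonicity, within one label because positions and values are ordered
alike. -/
theorem IsRunLabeling.le_of_sublist {σ π : Permutation} {g : Fin σ.length → ℕ}
    {h : Fin π.length → ℕ} (hg : σ.IsRunLabeling g) (hh : π.IsRunLabeling h)
    (hs : (σ.labelWord g).Sublist (π.labelWord h)) : σ ≤ π := by
  obtain ⟨f, hf⟩ := labelWord_sublist_labelWord_iff.1 hs
  have hgh : ∀ i, g i = h (π.letter.symm (f (σ.letter i))) := fun i => by simpa using hf (σ.letter i)
  have hmono : StrictMono fun i => π.letter.symm (f (σ.letter i)) := by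
    intro i j hij
    by_contra hle
    have hle := not_lt.1 hle
    have h1 := hh.1 hle
    rw [← hgh, ← hgh] at h1
    have heq := le_antisymm (hg.1 hij.le) h1
    have hlt := f.strictMono (hg.2 i j hij heq)
    rcases hle.eq_or_lt with h2 | h2
    · have := π.letter.symm.injective h2
      exact hlt.ne' this
    · have := hh.2 _ _ h2 (by rw [← hgh, ← hgh, heq])
      simp only [Equiv.apply_symm_apply] at this
      exact hlt.not_gt this
  exact ⟨OrderEmbedding.ofStrictMono _ hmono, fun i j => by simp⟩

theorem labelWord_run (π : Permutation) : π.labelWord (fun i => π.run i) = π.word := rfl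

/-- For permutations with the same number of descents, pattern containment is the subword order. -/
theorem le_iff_word_sublist {σ π : Permutation} (hdes : σ.des = π.des) :
    σ ≤ π ↔ σ.word.Sublist π.word := by
  constructor
  · rintro ⟨e, he⟩
    have hg := π.isRunLabeling_run.comp e he
    -- Equality of descents enters here: the pulled-back labeling is bounded by `σ.des`, hence is
    -- the run index of `σ`.
    have hrun := hg.eq_run fun i => by
      rw [hdes]
      exact run_le_des (e i).2.le
    rw [← labelWord_run, ← labelWord_run, labelWord_sublist_labelWord_iff]
    refine ⟨OrderEmbedding.ofStrictMono (fun v => π.letter (e (σ.letter.symm v))) ?_, fun v => ?_⟩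
    · intro v w hvw
      exact (he _ _).1 (by simpa using hvw)
    · change σ.run _ = π.run (π.letter.symm (π.letter (e (σ.letter.symm v))))
      rw [Equiv.symm_apply_apply]
      exact (hrun (σ.letter.symm v)).symm
  · exact σ.isRunLabeling_run.le_of_sublist π.isRunLabeling_run

/-- Every word is the word of a permutation with respect to some run labeling. -/
theorem exists_labelWord_eq (v : List ℕ) :
    ∃ (τ : Permutation) (g : Fin τ.length → ℕ), τ.IsRunLabeling g ∧ τ.labelWord g = v := by
  -- Stable sorting lists the indices of `v` by letter, equal letters in increasing order of index,
  -- which is what a run labeling requires.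
  refine ⟨⟨v.length, Tuple.sort v.get⟩, v.get ∘ Tuple.sort v.get,
    ⟨Tuple.monotone_sort _, fun i j hij h => ?_⟩, ?_⟩
  · exact (Tuple.eq_sort_iff.1 rfl).2 i j hij h
  · simp [labelWord]

theorem exists_word_eq {σ π : Permutation} (hdes : σ.des = π.des) {v : List ℕ}
    (hσ : σ.word.Sublist v) (hπ : v.Sublist π.word) :
    ∃ τ : Permutation, σ ≤ τ ∧ τ ≤ π ∧ τ.word = v := by
  obtain ⟨τ, g, hg, rfl⟩ := exists_labelWord_eq v
  have h1 := σ.isRunLabeling_run.le_of_sublist hg hσ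
  have h2 := hg.le_of_sublist π.isRunLabeling_run hπ
  refine ⟨τ, h1, h2, ?_⟩
  have hτ : τ.des = π.des := le_antisymm (des_mono h2) (hdes ▸ des_mono h1)
  -- The labels are letters of `π.word`, so they are at most `π.des = τ.des`, and uniqueness turns
  -- the labeling into the run index.
  have hrun := hg.eq_run fun i => by
    have hmem : g i ∈ π.word := hπ.subset (List.mem_ofFn.2 ⟨τ.letter i, by simp⟩)
    obtain ⟨w, hw⟩ := List.mem_ofFn.1 hmem
    rw [← hw, hτ]
    exact run_le_des (Fin.is_lt _).le
  rw [← labelWord_run]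
  congr 1
  exact (funext hrun).symm

theorem des_eq_of_mem_Icc {σ π τ : Permutation} (hdes : σ.des = π.des) (hτ : τ ∈ Set.Icc σ π) :
    τ.des = π.des :=
  le_antisymm (des_mono hτ.2) (hdes ▸ des_mono hτ.1)

end Permutation

/-- In the dual interval `⊥` is `π`, whose word is the longest, so going up the dual means deleting
letters. -/
theorem isDualCLShellable_Icc {σ π : Permutation} (hle : σ ≤ π) (hdes : σ.des = π.des) :
    IsDualCLShellable (Set.Icc σ π) := by
  have : Fact (σ ≤ π) := ⟨hle⟩
  refine isCLShellable_of_le_iff_sublist (P := (Set.Icc σ π)ᵒᵈ)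
    (word := fun τ => (OrderDual.ofDual τ).1.word) (fun a b => ?_) fun v h h' => ?_
  · refine Permutation.le_iff_word_sublist ?_
    exact (Permutation.des_eq_of_mem_Icc hdes (OrderDual.ofDual b).2).trans
      (Permutation.des_eq_of_mem_Icc hdes (OrderDual.ofDual a).2).symm
  · obtain ⟨τ, h1, h2, h3⟩ := Permutation.exists_word_eq hdes h h'
    exact ⟨OrderDual.toDual ⟨τ, h1, h2⟩, h3⟩

/-- Every interval of permutations with the same number of descents is dual CL-shellable, and it is
shellable. -/
theorem corollary2p6 (σ π : Permutation) (hle : σ ≤ π) (hdes : σ.des = π.des) :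
    IsDualCLShellable (Set.Icc σ π) ∧ IsShellable (orderComplex σ π) := by
  have hCL := isDualCLShellable_Icc hle hdes
  refine ⟨hCL, IsCLShellable.isShellable_chainComplex (V := Set.Ioo σ π) hCL
    (fun τ => OrderDual.toDual ⟨τ.1, τ.2.1.le, τ.2.2.le⟩) (fun _ _ => Iff.rfl) fun q => ?_⟩
  constructor
  · rintro ⟨τ, rfl⟩
    refine ⟨fun h => ?_, fun h => ?_⟩
    · exact τ.2.2.not_ge (h (OrderDual.toDual ⟨π, hle, le_rfl⟩))
    · exact τ.2.1.not_ge (h (OrderDual.toDual ⟨σ, le_rfl, hle⟩))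
  · rintro ⟨h1, h2⟩
    refine ⟨⟨(OrderDual.ofDual q).1, lt_of_le_of_ne (OrderDual.ofDual q).2.1 fun h => h2 fun p => ?_,
      lt_of_le_of_ne (OrderDual.ofDual q).2.2 fun h => h1 fun p => ?_⟩, rfl⟩
    · change (OrderDual.ofDual q).1 ≤ (OrderDual.ofDual p).1
      rw [← h]
      exact (OrderDual.ofDual p).2.1
    · change (OrderDual.ofDual p).1 ≤ (OrderDual.ofDual q).1
      rw [h]
      exact (OrderDual.ofDual p).2.2
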